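/- A \emph{Sup automaton on infinite words} is a tuple $\mathcal A=(\Sigma,Q,\iota,\delta)$, where $\Sigma$ is a finite nonempty alphabet, $Q$ a finite set of states, $\iota\in Q$ the initial state, and $\delta$ assigns to each $(q,\sigma)\in Q\times\Sigma$ a finite nonempty set $\delta(q,\sigma)\subseteq\mathbb Q\times Q$; an element $(x,q')\in\delta(q,\sigma)$ is a transition from $q$ to $q'$ over $\sigma$ with weight $x$. A run on $w=\sigma_0\sigma_1\cdots\in\Sigma^\omega$ is an infinite sequence of consecutive transitions over $\sigma_0,\sigma_1,\dots$ starting in $\iota$. The value of a run with weights $x_0,x_1,\dots$ is $\sup_n x_n$, and $\mathcal A(w)$ is the supremum of the values of all runs on $w$. In the \emph{letter game} on $\mathcal A$, in each turn Adam picks a letter and then Eve extends her run, which starts in $\iota$, by a transition over that letter; Eve wins the resulting infinite play if the value of her run is at least $\mathcal A(w)$, where $w$ is the word of Adam's letters. $\mathcal A$ is \emph{history-deterministic} (HD) if Eve has a winning strategy in the letter game. For $k\ge1$, in the \emph{$k$-token game} $G_k(\mathcal A)$, in each turn Adam picks a letter, then Eve extends her run by a transition over that letter, and then Adam extends each of his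 $k$ runs, which also start in $\iota$, by a transition over that letter; Eve wins the play if the value of her run is at least the maximum of the values of Adam's $k$ runs. Strategies may depend on the whole history of the play, and Eve \emph{wins} $G_k(\mathcal A)$ if she has a winning strategy in it. \textbf{Theorem.} A nondeterministic Sup automaton $\mathcal A$ on infinite words is HD if and only if Eve wins $G_2(\mathcal A)$. In contrast, $G_1$ does not characterise being HD: there is a nondeterministic Sup automaton $\mathcal A$ on infinite words such that Eve wins $G_1(\mathcal A)$ but $\mathcal A$ is not HD. -/

import Mathlib

universe u v

/-- A nondeterministic quantitative automaton over `Alphabet` with state space `State`: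
an initial state and a total transition function assigning to every state and letter a finite
nonempty set of weight-state pairs. Finiteness of `Alphabet` and `State` is imposed by type class
assumptions where automata are quantified over. -/
structure QuantAutomaton (Alphabet : Type u) (State : Type v) where
  init : State
  trans : State → Alphabet → Finset (ℚ × State)
  total : ∀ q a, (trans q a).Nonempty

/-- The value function `Sup` on infinite sequences of rational weights. (The weight sequences of
runs of automata with finitely many states and letters are bounded, see
`QuantAutomaton.bddAbove_weights`.) -/
noncomputable def supVal (x : ℕ → ℚ) : ℝ := ⨆ n, (x n : ℝ)

namespace QuantAutomaton

variable {Alphabet : Type u} {State : Type v}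

/-- The state reached after a finite sequence of moves `(x, q')` made from the initial state. -/
def lastState (A : QuantAutomaton Alphabet State) (moves : List (ℚ × State)) : State :=
  (moves.getLast?).elim A.init Prod.snd

/-- The state from which the `i`-th transition of an infinite sequence of moves is taken. -/
def stateAt (A : QuantAutomaton Alphabet State) (ρ : ℕ → ℚ × State) : ℕ → State
  | 0 => A.init
  | i + 1 => (ρ i).2

/-- `ρ` is a run of `A` on the infinite word `w`: its `i`-th transition goes from
`A.stateAt ρ i` over the letter `w i`, with weight `(ρ i).1`, to the state `(ρ i).2`. -/
def IsRun (A : QuantAutomaton Alphabet State) (w : ℕ → Alphabet) (ρ : ℕ → ℚ × State) : Prop :=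
  ∀ i, ρ i ∈ A.trans (A.stateAt ρ i) (w i)

/-- The value of a run, for the value function `Val`. -/
def runValue (Val : (ℕ → ℚ) → ℝ) (ρ : ℕ → ℚ × State) : ℝ := Val (fun i => (ρ i).1)

/-- The value of `A` on a word: the supremum of the values of the runs of `A` on it. -/
noncomputable def wordValue (A : QuantAutomaton Alphabet State) (Val : (ℕ → ℚ) → ℝ)
    (w : ℕ → Alphabet) : ℝ :=
  ⨆ ρ : {ρ : ℕ → ℚ × State // A.IsRun w ρ}, runValue Val ρ.1

/-- A strategy of Eve in the letter game: given the history of completed turns (Adam's letter and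
Eve's move) and Adam's new letter, it chooses a transition over that letter from the current state
of Eve's run. -/
structure LetterStrategy (A : QuantAutomaton Alphabet State) where
  move : List (Alphabet × (ℚ × State)) → Alphabet → ℚ × State
  legal : ∀ h a, move h a ∈ A.trans (A.lastState (h.map fun t => t.2)) a

/-- The play of the letter game with word `w` and moves `π` of Eve agrees with the strategy `s`. -/
def LetterStrategy.Agrees {A : QuantAutomaton Alphabet State} (s : A.LetterStrategy)
    (w : ℕ → Alphabet) (π : ℕ → ℚ × State) : Prop :=
  ∀ i, π i = s.move ((List.range i).map fun j => (w j, π j)) (w i)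

/-- `A`, with the value function `Val`, is history-deterministic: Eve has a strategy in the letter
game such that in all plays agreeing with it, her run has at least the value of the word. -/
def HistoryDeterministic (A : QuantAutomaton Alphabet State) (Val : (ℕ → ℚ) → ℝ) : Prop :=
  ∃ s : A.LetterStrategy, ∀ w π, s.Agrees w π → A.wordValue Val w ≤ runValue Val π

/-- A strategy of Eve in the `k`-token game: given the history of completed turns (Adam's letter,
Eve's move, and Adam's moves of his `k` tokens) and Adam's new letter, it chooses a transition over
that letter from the current state of Eve's run. -/
structure TokenStrategy (A : QuantAutomaton Alphabet State) (k : ℕ) where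
  move : List (Alphabet × (ℚ × State) × (Fin k → ℚ × State)) → Alphabet → ℚ × State
  legal : ∀ h a, move h a ∈ A.trans (A.lastState (h.map fun t => t.2.1)) a

/-- The play of the `k`-token game with word `w`, moves `π` of Eve and moves `τ j` of Adam's `j`-th
token agrees with the strategy `s`. -/
def TokenStrategy.Agrees {A : QuantAutomaton Alphabet State} {k : ℕ} (s : A.TokenStrategy k)
    (w : ℕ → Alphabet) (π : ℕ → ℚ × State) (τ : Fin k → ℕ → ℚ × State) : Prop :=
  ∀ i, π i = s.move ((List.range i).map fun m => (w m, π m, fun j => τ j m)) (w i)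

/-- Eve wins the `k`-token game on `A` with value function `Val`: she has a strategy such that in
all plays agreeing with it, in which Adam moves his tokens along runs on the word that he spells,
the value of her run is at least that of each of Adam's runs. -/
def EveWinsTokenGame (A : QuantAutomaton Alphabet State) (Val : (ℕ → ℚ) → ℝ) (k : ℕ) : Prop :=
  ∃ s : A.TokenStrategy k, ∀ w π τ, (∀ j, A.IsRun w (τ j)) → s.Agrees w π τ →
    ∀ j, runValue Val (τ j) ≤ runValue Val π

/-- The weights of a finite automaton are bounded. -/
theorem exists_weight_bound [Finite Alphabet] [Finite State]
    (A : QuantAutomaton Alphabet State) :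
    ∃ b : ℝ, ∀ q a, ∀ t ∈ A.trans q a, (t.1 : ℝ) ≤ b := by
  have h : (⋃ p : State × Alphabet,
      (fun t : ℚ × State => (t.1 : ℝ)) '' (A.trans p.1 p.2 : Set (ℚ × State))).Finite :=
    Set.finite_iUnion fun p => (A.trans p.1 p.2).finite_toSet.image _
  obtain ⟨b, hb⟩ := h.bddAbove
  exact ⟨b, fun q a t ht => hb (Set.mem_iUnion.2 ⟨(q, a), t, ht, rfl⟩)⟩

/-- The suprema in `supVal` over weight sequences of runs of finite automata are those of bounded
sets. -/
theorem bddAbove_weights [Finite Alphabet] [Finite State] (A : QuantAutomaton Alphabet State)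
    {w : ℕ → Alphabet} {ρ : ℕ → ℚ × State} (h : A.IsRun w ρ) :
    BddAbove (Set.range fun n => ((ρ n).1 : ℝ)) := by
  obtain ⟨b, hb⟩ := A.exists_weight_bound
  exact ⟨b, by rintro _ ⟨n, rfl⟩; exact hb _ _ _ (h n)⟩

/-- The suprema in `wordValue supVal` for finite automata are those of bounded sets. -/
theorem bddAbove_runValues [Finite Alphabet] [Finite State] (A : QuantAutomaton Alphabet State)
    (w : ℕ → Alphabet) :
    BddAbove (Set.range fun ρ : {ρ : ℕ → ℚ × State // A.IsRun w ρ} => runValue supVal ρ.1) := by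
  obtain ⟨b, hb⟩ := A.exists_weight_bound
  refine ⟨b, ?_⟩
  rintro _ ⟨ρ, rfl⟩
  exact ciSup_le fun n => hb _ _ _ (ρ.2 n)

/-- Every word has a run. -/
theorem exists_isRun (A : QuantAutomaton Alphabet State) (w : ℕ → Alphabet) :
    ∃ ρ, A.IsRun w ρ := by
  choose f hf using A.total
  let ρ : ℕ → ℚ × State := fun n =>
    Nat.rec (f A.init (w 0)) (fun i t => f t.2 (w (i + 1))) n
  refine ⟨ρ, fun i => ?_⟩
  cases i with
  | zero => exact hf _ _
  | succ i => exact hf _ _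

end QuantAutomaton

/-!
If `A` is history-deterministic, then Eve wins all token games by ignoring Adam's tokens. For the
converse, suppose that Eve wins the 2-token game. By induction on a finite set `T` of thresholds,
built from the largest threshold down, she has a strategy in the letter game that reaches every
threshold in `T` that some run on the word reaches (`TwoTokenStrategy.wins_finset`); with all
weights of `A` in `T` this is history-determinism.

The basic tool is `TwoTokenStrategy.wins_union`. A strategy in the letter game is a function of
Adam's letters. So if both of Adam's tokens follow such strategies, then Eve's answers form one too,
and it reaches all that either of them reaches. In particular, if Adam's first token can meet the
demand `F` and his second token can force the threshold `a`, then Eve's token can do both.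

Now let `a` be smaller than all elements of `T`, and let `F` be the demand to reach the thresholds
in `T` that are reached by some run. As long as no run has reached `a`, Eve answers as in the 2-token
game with all three tokens in her own state. This answer is good against every move of Adam's
tokens, in particular against both of them joining her in her new state, so that the next turn can
be treated in the same way. It also preserves the following invariant (`TwoTokenStrategy.Inv`): she
can still meet `F`, and for every finite word `v` on which `a` gets reached by some run from the
initial state, she has some run on `v` to a state where she can force `a` and meet what remains of
`F`. To see this, let Adam's first token meet `F` and his second token follow the run on `v` that
is given by the invariant, or in the beginning by the run that reaches `a`
(`TwoTokenStrategy.exists_runTo_wins`). When `a` gets reached on the word read so far, the invariant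
for the empty word says that Eve can force `a` and meet what remains of `F`, and she switches to a
strategy that does so. If `a` never gets reached, then neither does any threshold in `T`.

The automaton `waiting` shows that one token is not enough. It has a state in which a token waits
with weight 0 or leaves for good with weight 1 over one letter, and leaves with weight 2 over the
other one. In the 1-token game Eve waits until Adam's token has left. In the letter game she has to
leave at some time without being prompted, and then Adam plays the other letter.
-/

/-! ### Words, specifications and strategies in the letter game -/

namespace TokenGame

section Words

variable {L : Type u}

/-- The prefix of length `n` of an infinite word. -/
def pre (w : ℕ → L) (n : ℕ) : List L := (List.range n).map w

/-- The infinite word with first letter `b` and tail `w`. -/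
def cons (b : L) (w : ℕ → L) : ℕ → L
  | 0 => b
  | n + 1 => w n

theorem pre_succ (w : ℕ → L) (n : ℕ) : pre w (n + 1) = pre w n ++ [w n] := by
  simp [pre, List.range_succ]

theorem pre_cons_succ (b : L) (w : ℕ → L) (n : ℕ) : pre (cons b w) (n + 1) = b :: pre w n := by
  simp only [pre, List.range_succ_eq_map, List.map_cons, List.map_map]
  rfl

theorem cons_head_tail (w : ℕ → L) : cons (w 0) (fun n => w (n + 1)) = w := by
  funext n
  cases n <;> rfl

/-- A specification assigns to every infinite word the set of thresholds to be reached on it. -/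
abbrev Spec (L : Type u) := (ℕ → L) → Set ℚ

/-- What remains of a specification after a finite word has been read. -/
def Spec.after (F : Spec L) : List L → Spec L
  | [] => F
  | b :: u => Spec.after (fun w => F (cons b w)) u

end Words

/-- A transition system in which every state carries the set of thresholds that have been reached on
the way to it. -/
structure LevelSystem (L : Type u) (S : Type v) where
  /-- `step s b s'`: there is a transition from `s` to `s'` over the letter `b`. -/
  step : S → L → S → Prop
  /-- `reached t s`: the threshold `t` has been reached on the way to `s`. -/
  reached : ℚ → S → Prop
  total : ∀ s b, ∃ s', step s b s'
  reached_of_step : ∀ {s b s' t}, step s b s' → reached t s → reached t s'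

namespace LevelSystem

variable {L : Type u} {S : Type v} (X : LevelSystem L S)

/-- A strategy in the letter game from `s`, as the tree of the states that it visits: `σ u` is the
state in which it is after the finite word `u`. -/
def IsStrategy (s : S) (σ : List L → S) : Prop :=
  σ [] = s ∧ ∀ u b, X.step (σ u) b (σ (u ++ [b]))

/-- The threshold `t` is reached by the strategy `σ` on the infinite word `w`. -/
def Hits (σ : List L → S) (w : ℕ → L) (t : ℚ) : Prop := ∃ n, X.reached t (σ (pre w n))

/-- From `s` there is a strategy in the letter game that meets the specification `F`. -/
def Wins (F : Spec L) (s : S) : Prop := ∃ σ, X.IsStrategy s σ ∧ ∀ w, ∀ t ∈ F w, X.Hits σ w t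

/-- There is a run from `s` to `p` on a finite word. -/
def RunTo : S → List L → S → Prop
  | s, [], p => s = p
  | s, b :: u, p => ∃ s', X.step s b s' ∧ RunTo s' u p

variable {X}

theorem IsStrategy.step_nil {s : S} {σ : List L → S} (h : X.IsStrategy s σ) (b : L) :
    X.step s b (σ [b]) := by
  have := h.2 [] b
  rwa [h.1] at this

theorem IsStrategy.tail {s : S} {σ : List L → S} (h : X.IsStrategy s σ) (b : L) :
    X.IsStrategy (σ [b]) (fun u => σ (b :: u)) :=
  ⟨rfl, fun u c => h.2 (b :: u) c⟩

theorem IsStrategy.hits_tail {s : S} {σ : List L → S} (h : X.IsStrategy s σ) {b : L} {w : ℕ → L}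
    {t : ℚ} (ht : X.Hits σ (cons b w) t) : X.Hits (fun u => σ (b :: u)) w t := by
  obtain ⟨n, hn⟩ := ht
  cases n with
  | zero => exact ⟨0, X.reached_of_step (h.2 [] b) hn⟩
  | succ n => exact ⟨n, by rwa [pre_cons_succ] at hn⟩

theorem Wins.mono {F G : Spec L} (hFG : ∀ w, G w ⊆ F w) {s : S} (h : X.Wins F s) : X.Wins G s :=
  let ⟨σ, hσ, hF⟩ := h
  ⟨σ, hσ, fun w t ht => hF w t (hFG w ht)⟩

theorem Wins.exists_step {F : Spec L} {s : S} (h : X.Wins F s) (b : L) :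
    ∃ s', X.step s b s' ∧ X.Wins (fun w => F (cons b w)) s' :=
  let ⟨σ, hσ, hF⟩ := h
  ⟨σ [b], hσ.step_nil b, _, hσ.tail b, fun _ t ht => hσ.hits_tail (hF _ t ht)⟩

theorem exists_isStrategy (s : S) : ∃ σ, X.IsStrategy s σ := by
  choose f hf using X.total
  refine ⟨List.foldl f s, rfl, fun u b => ?_⟩
  rw [List.foldl_append]
  exact hf _ _

theorem wins_of_reached {a : ℚ} {s : S} (h : X.reached a s) : X.Wins (fun _ => {a}) s := by
  obtain ⟨σ, hσ⟩ := exists_isStrategy (X := X) s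
  refine ⟨σ, hσ, fun _ t ht => ⟨0, ?_⟩⟩
  rw [Set.mem_singleton_iff.1 ht]
  exact hσ.1.symm ▸ h

/-! ### From the 2-token game to the letter game -/

/-- A strategy in the 2-token game on a level system. The nodes `m : M` are the histories that agree
with the strategy, with the states of the three tokens after them. Eve's next state depends
only on the node and on Adam's letter. -/
structure TwoTokenStrategy (X : LevelSystem L S) (M : Type*) where
  eve : M → S
  fst : M → S
  snd : M → S
  /-- `next m m'`: the history `m'` extends `m` by one turn. -/
  next : M → M → Prop
  exists_move : ∀ m b, ∃ s', X.step (eve m) b s' ∧ ∀ x y, X.step (fst m) b x → X.step (snd m) b y →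
    ∃ m', next m m' ∧ eve m' = s' ∧ fst m' = x ∧ snd m' = y
  wins : ∀ μ : ℕ → M, (∀ n, next (μ n) (μ (n + 1))) → ∀ t n,
    X.reached t (fst (μ n)) ∨ X.reached t (snd (μ n)) → ∃ k, X.reached t (eve (μ k))

namespace TwoTokenStrategy

variable {M : Type*} (g : X.TwoTokenStrategy M)

/-- If Adam moves his tokens by strategies of the letter game, which depend on the letters only,
then Eve's answers are such a strategy as well, and it meets the specifications of both. -/
theorem wins_union (m : M) {F H : Spec L} (hF : X.Wins F (g.fst m)) (hH : X.Wins H (g.snd m)) :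
    X.Wins (fun w => F w ∪ H w) (g.eve m) := by
  obtain ⟨α, hα, hαF⟩ := hF
  obtain ⟨β, hβ, hβH⟩ := hH
  have key : ∀ m b, ∃ s', X.step (g.eve m) b s' ∧ ∀ x y, ∃ m',
      X.step (g.fst m) b x → X.step (g.snd m) b y →
        g.next m m' ∧ g.eve m' = s' ∧ g.fst m' = x ∧ g.snd m' = y := by
    intro m b
    obtain ⟨s', hs', h⟩ := g.exists_move m b
    refine ⟨s', hs', fun x y => ?_⟩
    by_cases hxy : X.step (g.fst m) b x ∧ X.step (g.snd m) b y
    · obtain ⟨m', hm'⟩ := h x y hxy.1 hxy.2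
      exact ⟨m', fun _ _ => hm'⟩
    · exact ⟨m, fun hx hy => (hxy ⟨hx, hy⟩).elim⟩
  choose s' hs' f hf using key
  -- The node reached after a finite word, which is read backwards.
  let ν : List L → M := fun u =>
    List.rec m (fun b v k => f k b (α (v.reverse ++ [b])) (β (v.reverse ++ [b]))) u
  have hν : ∀ u, g.fst (ν u) = α u.reverse ∧ g.snd (ν u) = β u.reverse := by
    intro u
    induction u with
    | nil => exact ⟨hα.1.symm, hβ.1.symm⟩
    | cons b u ih =>
      have := hf (ν u) b (α (u.reverse ++ [b])) (β (u.reverse ++ [b]))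
        (ih.1 ▸ hα.2 _ _) (ih.2 ▸ hβ.2 _ _)
      rw [List.reverse_cons]
      exact this.2.2
  have hstep : ∀ u b, g.next (ν u) (ν (b :: u)) ∧ g.eve (ν (b :: u)) = s' (ν u) b := by
    intro u b
    have := hf (ν u) b (α (u.reverse ++ [b])) (β (u.reverse ++ [b]))
      ((hν u).1 ▸ hα.2 _ _) ((hν u).2 ▸ hβ.2 _ _)
    exact ⟨this.1, this.2.1⟩
  refine ⟨fun u => g.eve (ν u.reverse), ⟨rfl, fun u b => ?_⟩, fun w t ht => ?_⟩
  · simp only [List.reverse_append, List.reverse_cons, List.reverse_nil, List.nil_append,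
      List.singleton_append]
    rw [(hstep _ b).2]
    exact hs' _ _
  · have hn : ∃ n, X.reached t (α (pre w n)) ∨ X.reached t (β (pre w n)) := by
      rcases ht with ht | ht
      · exact (hαF w t ht).imp fun _ => Or.inl
      · exact (hβH w t ht).imp fun _ => Or.inr
    obtain ⟨n, hn⟩ := hn
    refine g.wins (fun n => ν (pre w n).reverse) (fun k => ?_) t n ?_
    · simp only [pre_succ, List.reverse_append, List.reverse_cons, List.reverse_nil,
        List.nil_append, List.singleton_append]
      exact (hstep _ _).1
    · simpa only [(hν _).1, (hν _).2, List.reverse_reverse] using hn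

/-- Adam moves his first token by a strategy that meets `F`, and his second token along a run on `v`
to a state from which it reaches the threshold `a`. Then Eve's answers lead her on `v` to a state
from which she can reach `a` without giving up what remains of `F`. -/
theorem exists_runTo_wins {a : ℚ} (v : List L) (m : M) {F : Spec L} (hF : X.Wins F (g.fst m)) {p : S}
    (hp : X.RunTo (g.snd m) v p) (ha : X.Wins (fun _ => {a}) p) :
    ∃ q, X.RunTo (g.eve m) v q ∧ X.Wins (fun w => F.after v w ∪ {a}) q := by
  induction v generalizing m F with
  | nil => exact ⟨_, rfl, g.wins_union m hF ((show g.snd m = p from hp) ▸ ha)⟩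
  | cons b v ih =>
    obtain ⟨y, hy, hyp⟩ := hp
    obtain ⟨x, hx, hFx⟩ := hF.exists_step b
    obtain ⟨s', hs', h⟩ := g.exists_move m b
    obtain ⟨m', -, rfl, rfl, rfl⟩ := h x y hx hy
    obtain ⟨q, hq, hqF⟩ := ih m' hFx hyp
    exact ⟨q, ⟨_, hs', hq⟩, hqF⟩

/-- The invariant that Eve maintains while the threshold `a` has not been reached. Her state `s` is
one in which all three tokens of the 2-token game may be placed, she can meet `F`, and every
continuation `v` in `C`, on which `a` gets reached by some run, can lead her to a state from which
she can reach `a` without giving up what remains of `F`. -/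
def Inv (a : ℚ) (C : List L → Prop) (F : Spec L) (s : S) : Prop :=
  (∃ m, g.eve m = s ∧ g.fst m = s ∧ g.snd m = s) ∧ X.Wins F s ∧
    ∀ v, C v → ∃ p, X.RunTo s v p ∧ X.Wins (fun w => F.after v w ∪ {a}) p

/-- Eve answers as in the 2-token game with all tokens in her state. Her answer is good against all
moves of Adam's tokens, among them the one to her own new state. -/
theorem Inv.exists_step {a : ℚ} {C : List L → Prop} {F : Spec L} {s : S} (h : g.Inv a C F s)
    (b : L) : ∃ s', X.step s b s' ∧
      g.Inv a (fun v => C (b :: v)) (fun w => F (cons b w)) s' := by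
  obtain ⟨⟨m, hm, hm₁, hm₂⟩, hF, hC⟩ := h
  obtain ⟨s', hs', h⟩ := g.exists_move m b
  rw [hm] at hs'
  rw [hm₁, hm₂] at h
  obtain ⟨x, hx, hFx⟩ := hF.exists_step b
  refine ⟨s', hs', ?_, ?_, fun v hv => ?_⟩
  · obtain ⟨m', -, hm'⟩ := h s' s' hs' hs'
    exact ⟨m', hm'⟩
  · obtain ⟨m', -, rfl, rfl, hy⟩ := h x s' hx hs'
    obtain ⟨β, hβ⟩ := exists_isStrategy (X := X) (g.snd m')
    have := g.wins_union m' hFx (H := fun _ => ∅) ⟨β, hβ, fun _ _ ht => ht.elim⟩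
    exact this.mono fun w => Set.subset_union_left
  · obtain ⟨p, ⟨y, hy, hyp⟩, hp⟩ := hC _ hv
    obtain ⟨m', -, rfl, rfl, rfl⟩ := h x y hx hy
    exact g.exists_runTo_wins v m' hFx hyp (hp.mono fun w => Set.subset_union_right)

/-- Eve maintains the invariant until the word read is in `C`, and then switches to a strategy that
reaches `a` and meets what remains of `F`. -/
theorem Inv.wins {a : ℚ} {C : List L → Prop} {F H : Spec L} {s : S} (h : g.Inv a C F s)
    (hH : ∀ w, ∀ t ∈ H w, (t ∈ F w ∨ t = a) ∧ ∃ n, C (pre w n)) : X.Wins H s := by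
  let Z := {z : (List L → Prop) × Spec L × S // g.Inv a z.1 z.2.1 z.2.2}
  have hsw : ∀ z : Z, ∃ τ, z.1.1 [] →
      X.IsStrategy z.1.2.2 τ ∧ ∀ w, ∀ t ∈ z.1.2.1 w ∪ {a}, X.Hits τ w t := by
    intro z
    by_cases hz : z.1.1 []
    · obtain ⟨p, hp, hw⟩ := z.2.2.2 [] hz
      obtain rfl : z.1.2.2 = p := hp
      obtain ⟨τ, hτ⟩ := hw
      exact ⟨τ, fun _ => hτ⟩
    · exact ⟨fun _ => s, fun h => (hz h).elim⟩
  choose τ hτ using hsw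
  have hnx : ∀ (z : Z) (b : L), ∃ z' : Z, X.step z.1.2.2 b z'.1.2.2 ∧
      z'.1.1 = (fun v => z.1.1 (b :: v)) ∧ z'.1.2.1 = fun w => z.1.2.1 (cons b w) := by
    intro z b
    obtain ⟨s', hs', hi⟩ := z.2.exists_step g b
    exact ⟨⟨⟨_, _, s'⟩, hi⟩, hs', rfl, rfl⟩
  choose nx hnx₁ hnx₂ hnx₃ using hnx
  classical
  let ρ : List L → Z → S := fun u => List.rec (fun z => z.1.2.2)
    (fun b v r z => if z.1.1 [] then τ z (b :: v) else r (nx z b)) u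
  have hnil : ∀ z, ρ [] z = z.1.2.2 := fun z => rfl
  have hcons : ∀ b v z, ρ (b :: v) z = if z.1.1 [] then τ z (b :: v) else ρ v (nx z b) :=
    fun b v z => rfl
  clear_value ρ
  have hsame : ∀ z, z.1.1 [] → ∀ u, ρ u z = τ z u := by
    intro z hz u
    cases u with
    | nil => rw [hnil, (hτ z hz).1.1]
    | cons b v => rw [hcons, if_pos hz]
  have hρ : ∀ u b z, X.step (ρ u z) b (ρ (u ++ [b]) z) := by
    intro u
    induction u with
    | nil =>
      intro b z
      by_cases hz : z.1.1 []
      · rw [hsame z hz, hsame z hz]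
        exact (hτ z hz).1.2 _ _
      · rw [List.nil_append, hcons, if_neg hz]
        rw [hnil, hnil]
        exact hnx₁ z b
    | cons c u ih =>
      intro b z
      by_cases hz : z.1.1 []
      · rw [hsame z hz, hsame z hz]
        exact (hτ z hz).1.2 _ _
      · rw [List.cons_append, hcons, hcons, if_neg hz, if_neg hz]
        exact ih b _
  have hits : ∀ n (z : Z) w t, (t ∈ z.1.2.1 w ∨ t = a) → z.1.1 (pre w n) →
      X.Hits (fun u => ρ u z) w t := by
    intro n
    induction n with
    | zero =>
      intro z w t ht hn
      have := (hτ z hn).2 w t ht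
      simpa only [Hits, hsame z hn] using this
    | succ n ih =>
      intro z w t ht hn
      by_cases hz : z.1.1 []
      · have := (hτ z hz).2 w t ht
        simpa only [Hits, hsame z hz] using this
      · rw [← cons_head_tail w] at hn ht ⊢
        rw [pre_cons_succ] at hn
        obtain ⟨k, hk⟩ := ih (nx z (w 0)) (fun n => w (n + 1)) t (by rwa [hnx₃]) (by rwa [hnx₂])
        refine ⟨k + 1, ?_⟩
        simp only [pre_cons_succ, hcons, if_neg hz]
        exact hk
  refine ⟨fun u => ρ u ⟨⟨C, F, s⟩, h⟩, ⟨hnil _, fun u b => hρ u b _⟩, fun w t ht => ?_⟩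
  obtain ⟨ht', n, hn⟩ := hH w t ht
  exact hits n _ w t ht' hn

/-- If all tokens of the 2-token game may be placed in `s`, then Eve has a strategy in the letter
game from `s` that reaches all thresholds of a finite set that are reached by some run. -/
theorem wins_finset (hmono : ∀ {t t' p}, t' ≤ t → X.reached t p → X.reached t' p)
    {s : S} {m : M} (hm : g.eve m = s ∧ g.fst m = s ∧ g.snd m = s) (T : Finset ℚ) :
    X.Wins (fun w => {t | t ∈ T ∧ ∃ n p, X.RunTo s (pre w n) p ∧ X.reached t p}) s := by
  induction T using Finset.induction_on_min with
  | empty =>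
    obtain ⟨σ, hσ⟩ := exists_isStrategy (X := X) s
    exact ⟨σ, hσ, fun _ t ht => absurd ht.1 (Finset.notMem_empty t)⟩
  | insert a T haT ih =>
    have hinv : g.Inv a (fun v => ∃ p, X.RunTo s v p ∧ X.reached a p)
        (fun w => {t | t ∈ T ∧ ∃ n p, X.RunTo s (pre w n) p ∧ X.reached t p}) s := by
      refine ⟨⟨m, hm⟩, ih, ?_⟩
      rintro v ⟨p, hp, ha⟩
      have := g.exists_runTo_wins v m (hm.2.1.symm ▸ ih) (hm.2.2.symm ▸ hp) (wins_of_reached ha)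
      rwa [hm.2.1, hm.1] at this
    refine hinv.wins g ?_
    rintro w t ⟨ht, n, p, hp, htp⟩
    rcases Finset.mem_insert.1 ht with rfl | ht
    · exact ⟨Or.inr rfl, n, p, hp, htp⟩
    · exact ⟨Or.inl ⟨ht, n, p, hp, htp⟩, n, p, hp, hmono (haT t ht).le htp⟩

end TwoTokenStrategy

end LevelSystem

end TokenGame

/-! ### Runs and their values -/

namespace QuantAutomaton

open TokenGame

variable {Alphabet : Type u} {State : Type v}

theorem lastState_append_singleton (A : QuantAutomaton Alphabet State) (h : List (ℚ × State))
    (t : ℚ × State) : A.lastState (h ++ [t]) = t.2 := by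
  simp [lastState]

theorem lastState_pre (A : QuantAutomaton Alphabet State) (ρ : ℕ → ℚ × State) (n : ℕ) :
    A.lastState (pre ρ n) = A.stateAt ρ n := by
  cases n with
  | zero => rfl
  | succ n => rw [pre_succ, lastState_append_singleton, stateAt]

theorem isRun_iff {A : QuantAutomaton Alphabet State} {w : ℕ → Alphabet} {ρ : ℕ → ℚ × State} :
    A.IsRun w ρ ↔ ∀ n, ρ n ∈ A.trans (A.lastState (pre ρ n)) (w n) := by
  simp only [IsRun, lastState_pre]

theorem LetterStrategy.Agrees.isRun {A : QuantAutomaton Alphabet State} {s : A.LetterStrategy}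
    {w : ℕ → Alphabet} {π : ℕ → ℚ × State} (h : s.Agrees w π) : A.IsRun w π := by
  refine isRun_iff.2 fun n => ?_
  have := s.legal ((List.range n).map fun j => (w j, π j)) (w n)
  rw [← h n, List.map_map] at this
  exact this

theorem TokenStrategy.Agrees.isRun {A : QuantAutomaton Alphabet State} {k : ℕ}
    {s : A.TokenStrategy k} {w : ℕ → Alphabet} {π : ℕ → ℚ × State} {τ : Fin k → ℕ → ℚ × State}
    (h : s.Agrees w π τ) : A.IsRun w π := by
  refine isRun_iff.2 fun n => ?_
  have := s.legal ((List.range n).map fun m => (w m, π m, fun j => τ j m)) (w n)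
  rw [← h n, List.map_map] at this
  exact this

theorem exists_finset_weights [Finite Alphabet] [Finite State]
    (A : QuantAutomaton Alphabet State) :
    ∃ T : Finset ℚ, ∀ q a, ∀ t ∈ A.trans q a, t.1 ∈ T := by
  have h : (⋃ p : State × Alphabet,
      Prod.fst '' (A.trans p.1 p.2 : Set (ℚ × State))).Finite :=
    Set.finite_iUnion fun p => (A.trans p.1 p.2).finite_toSet.image _
  exact ⟨h.toFinset, fun q a t ht => h.mem_toFinset.2 (Set.mem_iUnion.2 ⟨(q, a), t, ht, rfl⟩)⟩

theorem le_runValue_supVal [Finite Alphabet] [Finite State] {A : QuantAutomaton Alphabet State}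
    {w : ℕ → Alphabet} {ρ : ℕ → ℚ × State} (h : A.IsRun w ρ) (n : ℕ) :
    ((ρ n).1 : ℝ) ≤ runValue supVal ρ :=
  le_ciSup (A.bddAbove_weights h) n

theorem runValue_supVal_le {ρ : ℕ → ℚ × State} {x : ℝ} (h : ∀ n, ((ρ n).1 : ℝ) ≤ x) :
    runValue supVal ρ ≤ x :=
  ciSup_le h

/-- The value of a run is attained. -/
theorem le_runValue_supVal_iff [Finite Alphabet] [Finite State]
    {A : QuantAutomaton Alphabet State} {w : ℕ → Alphabet} {ρ : ℕ → ℚ × State}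
    (h : A.IsRun w ρ) (t : ℚ) : (t : ℝ) ≤ runValue supVal ρ ↔ ∃ n, t ≤ (ρ n).1 := by
  constructor
  · intro ht
    obtain ⟨T, hT⟩ := A.exists_finset_weights
    have hfin : (Set.range fun n => (ρ n).1).Finite :=
      T.finite_toSet.subset (by rintro _ ⟨n, rfl⟩; exact hT _ _ _ (h n))
    obtain ⟨_, ⟨n, rfl⟩, hn⟩ := Set.exists_max_image _ id hfin (Set.range_nonempty _)
    refine ⟨n, ?_⟩
    have : runValue supVal ρ ≤ ((ρ n).1 : ℝ) :=
      runValue_supVal_le fun k => by exact_mod_cast hn _ ⟨k, rfl⟩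
    exact_mod_cast ht.trans this
  · rintro ⟨n, hn⟩
    exact le_trans (by exact_mod_cast hn) (le_runValue_supVal h n)

theorem runValue_le_wordValue [Finite Alphabet] [Finite State]
    {A : QuantAutomaton Alphabet State} {w : ℕ → Alphabet} {ρ : ℕ → ℚ × State} (h : A.IsRun w ρ) :
    runValue supVal ρ ≤ A.wordValue supVal w :=
  le_ciSup (A.bddAbove_runValues w) ⟨ρ, h⟩

/-! ### Automata as level systems -/

/-- The level system of an automaton: its states are the finite sequences of moves, and a threshold
has been reached if one of the moves has at least that weight. -/
def levelSystem (A : QuantAutomaton Alphabet State) :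
    LevelSystem Alphabet (List (ℚ × State)) where
  step h b h' := ∃ t ∈ A.trans (A.lastState h) b, h' = h ++ [t]
  reached x h := ∃ t ∈ h, x ≤ t.1
  total h b := (A.total (A.lastState h) b).elim fun t ht => ⟨_, t, ht, rfl⟩
  reached_of_step := by
    rintro s b _ x ⟨t, -, rfl⟩ ⟨t', ht', hx⟩
    exact ⟨t', List.mem_append_left _ ht', hx⟩

theorem reached_pre_iff (A : QuantAutomaton Alphabet State) {x : ℚ} {ρ : ℕ → ℚ × State} {n : ℕ} :
    A.levelSystem.reached x (pre ρ n) ↔ ∃ k < n, x ≤ (ρ k).1 := by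
  constructor
  · rintro ⟨t, ht, hx⟩
    obtain ⟨k, hk, rfl⟩ := List.mem_map.1 ht
    exact ⟨k, List.mem_range.1 hk, hx⟩
  · rintro ⟨k, hk, hx⟩
    exact ⟨_, List.mem_map_of_mem (List.mem_range.2 hk), hx⟩

theorem runTo_pre {A : QuantAutomaton Alphabet State} {w : ℕ → Alphabet} {ρ : ℕ → ℚ × State}
    (h : A.IsRun w ρ) (n : ℕ) : A.levelSystem.RunTo [] (pre w n) (pre ρ n) := by
  have append : ∀ (u : List Alphabet) b s p p', A.levelSystem.RunTo s u p →
      A.levelSystem.step p b p' → A.levelSystem.RunTo s (u ++ [b]) p' := by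
    intro u
    induction u with
    | nil =>
      rintro b s p p' rfl hs
      exact ⟨p', hs, rfl⟩
    | cons c u ih =>
      rintro b s p p' ⟨s', hs', hp⟩ hs
      exact ⟨s', hs', ih b s' p p' hp hs⟩
  induction n with
  | zero => rfl
  | succ n ih =>
    rw [pre_succ, pre_succ]
    exact append _ _ _ _ _ ih ⟨ρ n, isRun_iff.1 h n, rfl⟩

/-- A strategy in the level system of `A` that reaches all weights reached by runs of `A` is a
winning strategy in the letter game on `A`. -/
theorem historyDeterministic_of_wins [Finite Alphabet] [Finite State]
    {A : QuantAutomaton Alphabet State} {T : Finset ℚ} (hT : ∀ q a, ∀ t ∈ A.trans q a, t.1 ∈ T)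
    (h : A.levelSystem.Wins (fun w => {t | t ∈ T ∧ ∃ n p,
      A.levelSystem.RunTo [] (pre w n) p ∧ A.levelSystem.reached t p}) []) :
    A.HistoryDeterministic supVal := by
  classical
  obtain ⟨σ, ⟨hσ₀, hσ⟩, hwin⟩ := h
  choose f hf hfσ using hσ
  -- The moves of `σ` are illegal after histories that disagree with it: there, any move will do.
  let s : A.LetterStrategy :=
    { move := fun h a =>
        if A.lastState (h.map fun t => t.2) = A.lastState (σ (h.map Prod.fst)) then
          f (h.map Prod.fst) a
        else (A.total (A.lastState (h.map fun t => t.2)) a).choose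
      legal := fun h a => by
        split_ifs with hs
        · rw [hs]
          exact hf _ _
        · exact (A.total _ a).choose_spec }
  refine ⟨s, fun w π hπ => ?_⟩
  have hpre : ∀ n, pre π n = σ (pre w n) := by
    intro n
    induction n with
    | zero => exact hσ₀.symm
    | succ n ih =>
      have h₁ : ((List.range n).map fun j => (w j, π j)).map Prod.fst = pre w n := by
        simp [pre]
      have h₂ : ((List.range n).map fun j => (w j, π j)).map (fun t => t.2) = pre π n := by
        simp [pre]
      have hn : π n = f (pre w n) (w n) := by
        rw [hπ n]
        simp only [s, h₁, h₂]
        rw [if_pos (by rw [ih])]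
      rw [pre_succ, pre_succ, hfσ, ih, hn]
  have : Nonempty {ρ : ℕ → ℚ × State // A.IsRun w ρ} :=
    let ⟨ρ, hρ⟩ := A.exists_isRun w
    ⟨⟨ρ, hρ⟩⟩
  refine ciSup_le fun ⟨ρ, hρ⟩ => runValue_supVal_le fun n => ?_
  rw [le_runValue_supVal_iff hπ.isRun]
  obtain ⟨k, hk⟩ := hwin w (ρ n).1
    ⟨hT _ _ _ (hρ n), n + 1, _, runTo_pre hρ _, A.reached_pre_iff.2 ⟨n, n.lt_succ_self, le_rfl⟩⟩
  rw [← hpre, reached_pre_iff] at hk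
  exact hk.imp fun _ => And.right

/-- The finite histories of the `k`-token game that agree with a strategy of Eve. -/
inductive TokenStrategy.History {A : QuantAutomaton Alphabet State} {k : ℕ}
    (s : A.TokenStrategy k) : List (Alphabet × (ℚ × State) × (Fin k → ℚ × State)) → Prop
  | nil : History s []
  | append {h} (a : Alphabet) (τ : Fin k → ℚ × State) (hh : History s h)
      (hτ : ∀ j, τ j ∈ A.trans (A.lastState (h.map fun t => t.2.2 j)) a) :
      History s (h ++ [(a, s.move h a, τ)])

theorem TokenStrategy.History.of_append {A : QuantAutomaton Alphabet State} {k : ℕ}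
    {s : A.TokenStrategy k} {h : List (Alphabet × (ℚ × State) × (Fin k → ℚ × State))}
    {t : Alphabet × (ℚ × State) × (Fin k → ℚ × State)} (H : s.History (h ++ [t])) :
    s.History h ∧ t.2.1 = s.move h t.1 ∧
      ∀ j, t.2.2 j ∈ A.trans (A.lastState (h.map fun t => t.2.2 j)) t.1 := by
  generalize hl : h ++ [t] = l at H
  cases H with
  | nil => simp at hl
  | append a τ hh hτ =>
    obtain ⟨rfl, ht⟩ := List.append_inj' hl rfl
    obtain rfl := List.singleton_injective ht
    exact ⟨hh, rfl, hτ⟩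

theorem TokenStrategy.History.of_pre {A : QuantAutomaton Alphabet State} {k : ℕ}
    {s : A.TokenStrategy k} {p : ℕ → Alphabet × (ℚ × State) × (Fin k → ℚ × State)} {d : ℕ} :
    ∀ {n}, s.History (pre p (n + d)) → s.History (pre p n) := by
  induction d with
  | zero => exact id
  | succ d ih =>
    intro n h
    rw [← add_assoc, pre_succ] at h
    exact ih h.of_append.1

/-- An infinite sequence of finite histories, each of which extends the one before it by one turn,
comes from an infinite sequence of turns. -/
theorem exists_eq_pre {α : Type*} (l : ℕ → List α) (h : ∀ n, ∃ t, l (n + 1) = l n ++ [t]) :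
    ∃ p : ℕ → α, ∀ n, l n = pre p ((l 0).length + n) := by
  choose t ht using h
  let p : ℕ → α := fun i => if hi : i < (l 0).length then (l 0)[i] else t (i - (l 0).length)
  refine ⟨p, fun n => ?_⟩
  induction n with
  | zero =>
    refine List.ext_getElem (by simp [pre]) fun i hi _ => ?_
    simp [pre, p, hi]
  | succ n ih =>
    rw [ht, ← add_assoc, pre_succ, ← ih]
    simp [p]

/-- Histories of the 2-token game on an automaton as nodes of a strategy on its level system. -/
def TokenStrategy.toTwoTokenStrategy [Finite Alphabet] [Finite State]
    {A : QuantAutomaton Alphabet State} (s : A.TokenStrategy 2)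
    (hs : ∀ w π τ, (∀ j, A.IsRun w (τ j)) → s.Agrees w π τ →
      ∀ j, runValue supVal (τ j) ≤ runValue supVal π) :
    A.levelSystem.TwoTokenStrategy {h // s.History h} where
  eve h := h.1.map fun t => t.2.1
  fst h := h.1.map fun t => t.2.2 0
  snd h := h.1.map fun t => t.2.2 1
  next h h' := ∃ t, h'.1 = h.1 ++ [t]
  exists_move := by
    rintro ⟨h, hh⟩ b
    refine ⟨_, ⟨s.move h b, s.legal h b, rfl⟩, ?_⟩
    rintro _ _ ⟨t₀, ht₀, rfl⟩ ⟨t₁, ht₁, rfl⟩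
    refine ⟨⟨h ++ [(b, s.move h b, ![t₀, t₁])], hh.append b _ ?_⟩, ⟨_, rfl⟩, ?_, ?_, ?_⟩
    · intro j
      fin_cases j
      exacts [ht₀, ht₁]
    all_goals simp
  wins := by
    intro μ hμ x n hn
    obtain ⟨p, hp⟩ := exists_eq_pre (fun n => (μ n).1) hμ
    set c := (μ 0).1.length
    have hist : ∀ i, s.History (pre p i) := fun i =>
      TokenStrategy.History.of_pre (d := c) (by rw [add_comm, ← hp]; exact (μ i).2)
    have hturn := fun i => (pre_succ p i ▸ hist (i + 1) : s.History (pre p i ++ [p i])).of_append.2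
    have map_pre : ∀ (f : Alphabet × (ℚ × State) × (Fin 2 → ℚ × State) → ℚ × State) i,
        (pre p i).map f = pre (fun m => f (p m)) i := fun f i => by simp [pre]
    have hrun : ∀ j, A.IsRun (fun i => (p i).1) (fun i => (p i).2.2 j) := fun j =>
      isRun_iff.2 fun i => by
        have := (hturn i).2 j
        rwa [map_pre] at this
    have hag : s.Agrees (fun i => (p i).1) (fun i => (p i).2.1) (fun j i => (p i).2.2 j) :=
      fun i => (hturn i).1
    have hle := hs _ _ _ hrun hag
    have hj : ∃ j i, x ≤ ((p i).2.2 j).1 := by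
      rw [hp, map_pre, map_pre, reached_pre_iff, reached_pre_iff] at hn
      rcases hn with ⟨i, -, hi⟩ | ⟨i, -, hi⟩
      exacts [⟨0, i, hi⟩, ⟨1, i, hi⟩]
    obtain ⟨j, hj⟩ := hj
    obtain ⟨i, hi⟩ := (le_runValue_supVal_iff hag.isRun x).1
      (((le_runValue_supVal_iff (hrun j) x).2 hj).trans (hle j))
    refine ⟨i + 1, ?_⟩
    rw [hp, map_pre, reached_pre_iff]
    exact ⟨i, by omega, hi⟩

theorem HistoryDeterministic.eveWinsTokenGame [Finite Alphabet] [Finite State]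
    {A : QuantAutomaton Alphabet State} (h : A.HistoryDeterministic supVal) (k : ℕ) :
    A.EveWinsTokenGame supVal k := by
  obtain ⟨s, hs⟩ := h
  refine ⟨⟨fun h a => s.move (h.map fun t => (t.1, t.2.1)) a, fun h a => ?_⟩,
    fun w π τ hτ hag j => ?_⟩
  · have := s.legal (h.map fun t => (t.1, t.2.1)) a
    rwa [List.map_map] at this
  · refine (runValue_le_wordValue (hτ j)).trans (hs w π fun i => ?_)
    rw [hag i]
    change s.move (List.map _ (List.map _ _)) _ = _
    rw [List.map_map]
    rfl

theorem EveWinsTokenGame.historyDeterministic [Finite Alphabet] [Finite State]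
    {A : QuantAutomaton Alphabet State} (h : A.EveWinsTokenGame supVal 2) :
    A.HistoryDeterministic supVal := by
  obtain ⟨s, hs⟩ := h
  obtain ⟨T, hT⟩ := A.exists_finset_weights
  refine historyDeterministic_of_wins hT ?_
  refine (s.toTwoTokenStrategy hs).wins_finset ?_ (m := ⟨[], .nil⟩) ⟨rfl, rfl, rfl⟩ T
  rintro t t' p htt' ⟨m, hm, hle⟩
  exact ⟨m, hm, htt'.trans hle⟩

end QuantAutomaton

/-! ### One token is not enough -/

namespace QuantAutomaton

open TokenGame

/-- Every word has a play of the letter game that agrees with a given strategy. -/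
theorem LetterStrategy.exists_agrees {Alphabet : Type u} {State : Type v}
    {A : QuantAutomaton Alphabet State} (s : A.LetterStrategy) (w : ℕ → Alphabet) :
    ∃ π, s.Agrees w π := by
  let l : ℕ → List (Alphabet × (ℚ × State)) := fun n =>
    Nat.rec [] (fun n h => h ++ [(w n, s.move h (w n))]) n
  have hl : ∀ n, (List.range n).map (fun j => (w j, s.move (l j) (w j))) = l n := by
    intro n
    induction n with
    | zero => rfl
    | succ n ih => rw [List.range_succ, List.map_append, ih]; rfl
  exact ⟨fun n => s.move (l n) (w n), fun n => by rw [hl]⟩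

/-- Plays on two words with a common prefix that agree with the same strategy coincide on it. -/
theorem LetterStrategy.Agrees.eq_of_lt {Alphabet : Type u} {State : Type v}
    {A : QuantAutomaton Alphabet State} {s : A.LetterStrategy} {w w' : ℕ → Alphabet}
    {π π' : ℕ → ℚ × State} (h : s.Agrees w π) (h' : s.Agrees w' π') {n : ℕ}
    (hw : ∀ i < n, w i = w' i) : ∀ i < n, π i = π' i := by
  intro i
  induction i using Nat.strong_induction_on with
  | _ i ih =>
    intro hi
    rw [h i, h' i, hw i hi]
    congr 1
    refine List.map_congr_left fun j hj => ?_
    have hj' := List.mem_range.1 hj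
    rw [hw j (hj'.trans hi), ih j hj' (hj'.trans hi)]

/-- The automaton with states `false` (waiting) and `true` (done). Waiting over the letter `false`,
it may wait on with weight 0 or be done with weight 1; over the letter `true` it is done with
weight 2. Once it is done, all weights are 0. -/
def waiting : QuantAutomaton Bool Bool where
  init := false
  trans
    | false, false => {(0, false), (1, true)}
    | false, true => {(2, true)}
    | true, _ => {(0, true)}
  total q a := by cases q <;> cases a <;> simp

/-- Eve's strategy in the 1-token game on `waiting`: she waits until Adam's token is done. -/
def waitingStrategy : waiting.TokenStrategy 1 where
  move h a :=
    if waiting.lastState (h.map fun t => t.2.1) then (0, true)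
    else if a then (2, true)
    else if waiting.lastState (h.map fun t => t.2.2 0) then (1, true)
    else (0, false)
  legal h a := by
    cases waiting.lastState (h.map fun t => t.2.1) <;> cases a <;>
      cases waiting.lastState (h.map fun t => t.2.2 0) <;> simp [waiting]

theorem eveWinsTokenGame_waiting : waiting.EveWinsTokenGame supVal 1 := by
  refine ⟨waitingStrategy, fun w π τ hτ hag j => ?_⟩
  obtain rfl : j = 0 := Subsingleton.elim _ _
  have hπ := hag.isRun
  have move : ∀ n, π n = if waiting.stateAt π n then (0, true)
      else if w n then (2, true)
      else if waiting.stateAt (τ 0) n then (1, true)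
      else (0, false) := by
    intro n
    rw [hag n]
    simp only [waitingStrategy, List.map_map, ← lastState_pre]
    rfl
  have token := hτ 0
  have inv : ∀ n,
      (waiting.stateAt π n = false ∧ waiting.stateAt (τ 0) n = false ∧
        ∀ i < n, (τ 0 i).1 ≤ 0) ∨
      (waiting.stateAt π n = false ∧ waiting.stateAt (τ 0) n = true ∧
        ∀ i < n, (τ 0 i).1 ≤ 1) ∨
      (waiting.stateAt π n = true ∧ waiting.stateAt (τ 0) n = true ∧
        ∃ m, 0 ≤ (π m).1 ∧ ∀ i < n, (τ 0 i).1 ≤ (π m).1) := by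
    intro n
    induction n with
    | zero => exact Or.inl ⟨rfl, rfl, by simp⟩
    | succ n ih =>
      have hm := move n
      have ht := token n
      rcases ih with ⟨hp, hq, h⟩ | ⟨hp, hq, h⟩ | ⟨hp, hq, m, h0, h⟩
      · rw [hp, hq] at hm
        rw [hq] at ht
        cases hw : w n with
        | true =>
          rw [hw] at hm ht
          simp only [waiting, Finset.mem_singleton] at ht
          refine Or.inr (Or.inr ⟨by simp [stateAt, hm], by simp [stateAt, ht], n, by simp [hm],
            Nat.forall_lt_succ_right.2 ⟨fun i hi => (h i hi).trans (by simp [hm]), ?_⟩⟩)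
          simp [ht, hm]
        | false =>
          rw [hw] at hm ht
          simp only [waiting, Finset.mem_insert, Finset.mem_singleton] at ht
          rcases ht with ht | ht
          · exact Or.inl ⟨by simp [stateAt, hm], by simp [stateAt, ht],
              Nat.forall_lt_succ_right.2 ⟨h, by simp [ht]⟩⟩
          · exact Or.inr (Or.inl ⟨by simp [stateAt, hm], by simp [stateAt, ht],
              Nat.forall_lt_succ_right.2 ⟨fun i hi => (h i hi).trans zero_le_one, by simp [ht]⟩⟩)
      · rw [hp, hq] at hm
        rw [hq] at ht
        simp only [waiting, Finset.mem_singleton] at ht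
        have h1 : 1 ≤ (π n).1 ∧ (π n).2 = true := by
          cases hw : w n <;> rw [hm, hw] <;> simp
        exact Or.inr (Or.inr ⟨h1.2, by simp [stateAt, ht], n, zero_le_one.trans h1.1,
          Nat.forall_lt_succ_right.2 ⟨fun i hi => (h i hi).trans h1.1,
            by rw [ht]; exact zero_le_one.trans h1.1⟩⟩)
      · rw [hp] at hm
        rw [hq] at ht
        simp only [waiting, Finset.mem_singleton] at ht
        exact Or.inr (Or.inr ⟨by simp [stateAt, hm], by simp [stateAt, ht], m, h0,
          Nat.forall_lt_succ_right.2 ⟨h, by rw [ht]; exact h0⟩⟩)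
  have nonneg : ∀ n, 0 ≤ (π n).1 := by
    intro n
    rw [move n]
    split_ifs <;> simp
  refine runValue_supVal_le fun n => ?_
  rw [le_runValue_supVal_iff hπ]
  -- Eve is at most one turn behind: what Adam gets in turn `n` she has got by turn `n + 1`.
  rcases inv (n + 1) with ⟨-, -, h⟩ | ⟨hp, hq, h⟩ | ⟨-, -, m, -, h⟩
  · exact ⟨0, (h n n.lt_succ_self).trans (nonneg 0)⟩
  · refine ⟨n + 1, (h n n.lt_succ_self).trans ?_⟩
    rw [move (n + 1), hp, hq]
    cases w (n + 1) <;> simp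
  · exact ⟨m, h n n.lt_succ_self⟩

/-- As long as Adam plays `false`, Eve has to be done at some time in order to collect the weight 1;
then Adam plays `true`, and a token that is still waiting collects the weight 2. -/
theorem not_historyDeterministic_waiting : ¬ waiting.HistoryDeterministic supVal := by
  rintro ⟨s, hs⟩
  obtain ⟨π, hπ⟩ := s.exists_agrees fun _ => false
  have hdone : waiting.IsRun (fun _ => false)
      (fun n => if n = 0 then (1, true) else (0, true)) := by
    rintro (_ | _ | n) <;> simp [waiting, stateAt]
  obtain ⟨n, hn⟩ := (le_runValue_supVal_iff hπ.isRun 1).1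
    (((le_runValue_supVal_iff hdone 1).2 ⟨0, by simp⟩).trans
      ((runValue_le_wordValue hdone).trans (hs _ _ hπ)))
  let w : ℕ → Bool := fun i => decide (i = n + 1)
  obtain ⟨π', hπ'⟩ := s.exists_agrees w
  have heq : ∀ i < n + 1, π i = π' i := hπ.eq_of_lt hπ' fun i hi => by
    simp only [w]
    exact (decide_eq_false (by omega)).symm
  have hrun : waiting.IsRun w (fun i =>
      if i < n + 1 then (0, false) else if i = n + 1 then (2, true) else (0, true)) := by
    rintro (_ | i)
    · simp [waiting, stateAt, w]
    · rcases lt_trichotomy i n with hi | rfl | hi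
      · simp [waiting, stateAt, w, hi, hi.ne, hi.trans n.lt_succ_self]
      · simp [waiting, stateAt, w]
      · have h1 : ¬ i < n + 1 := by omega
        have h2 : ¬ i < n := by omega
        have h3 : i ≠ n := by omega
        by_cases h4 : i = n + 1 <;> simp [waiting, stateAt, w, h1, h2, h3, h4]
  have hrun' := hπ'.isRun
  have done : ∀ i, waiting.stateAt π' (n + 1 + i) = true := by
    intro i
    induction i with
    | zero =>
      have h := hrun' n
      have hn' : 1 ≤ (π' n).1 := heq n n.lt_succ_self ▸ hn
      have hw : w n = false := decide_eq_false (by omega)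
      rw [hw] at h
      change (π' n).2 = true
      cases hst : waiting.stateAt π' n <;> rw [hst] at h
      · simp only [waiting, Finset.mem_insert, Finset.mem_singleton] at h
        rcases h with h | h
        · rw [h] at hn'
          norm_num at hn'
        · rw [h]
      · simp only [waiting, Finset.mem_singleton] at h
        rw [h]
    | succ i ih =>
      have h := hrun' (n + 1 + i)
      rw [ih] at h
      simp only [waiting, Finset.mem_singleton] at h
      change (π' (n + 1 + i)).2 = true
      rw [h]
  obtain ⟨k, hk⟩ := (le_runValue_supVal_iff hrun' 2).1
    (((le_runValue_supVal_iff hrun 2).2 ⟨n + 1, by simp⟩).trans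
      ((runValue_le_wordValue hrun).trans (hs _ _ hπ')))
  have h := hrun' k
  rcases lt_or_ge k (n + 1) with hlt | hge
  · have hw : w k = false := decide_eq_false (by omega)
    rw [hw] at h
    cases hst : waiting.stateAt π' k <;> rw [hst] at h <;>
      simp only [waiting, Finset.mem_insert, Finset.mem_singleton] at h
    · rcases h with h | h <;> rw [h] at hk <;> norm_num at hk
    · rw [h] at hk
      norm_num at hk
  · obtain ⟨i, rfl⟩ := Nat.exists_eq_add_of_le hge
    rw [done] at h
    simp only [waiting, Finset.mem_singleton] at h
    rw [h] at hk
    norm_num at hk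

end QuantAutomaton

theorem mainTheorem7 :
    (∀ (Alphabet : Type u) (State : Type v) [Finite Alphabet] [Nonempty Alphabet] [Finite State]
      (A : QuantAutomaton Alphabet State),
      A.HistoryDeterministic supVal ↔ A.EveWinsTokenGame supVal 2) ∧
    (∃ (Alphabet State : Type) (_ : Finite Alphabet) (_ : Nonempty Alphabet) (_ : Finite State)
      (A : QuantAutomaton Alphabet State),
      A.EveWinsTokenGame supVal 1 ∧ ¬ A.HistoryDeterministic supVal) := by
  refine ⟨fun Alphabet State _ _ _ A =>
    ⟨fun h => h.eveWinsTokenGame 2, QuantAutomaton.EveWinsTokenGame.historyDeterministic⟩, ?_⟩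
  exact ⟨Bool, Bool, inferInstance, inferInstance, inferInstance, QuantAutomaton.waiting,
    QuantAutomaton.eveWinsTokenGame_waiting, QuantAutomaton.not_historyDeterministic_waiting⟩
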